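/- **Theorem.** A *Motzkin permutation* of length $n\ge 0$ is a permutation $\pi=\pi_1\cdots\pi_n$ of $\{1,\dots,n\}$ that avoids the classical pattern $132$ and for which there are no indices $a<b$ with $\pi_a<\pi_b<\pi_{b+1}$. Let $\mathfrak M_n$ be the set of these permutations. For $j\ge 2$ let $12\text{-}3\text{-}\cdots\text{-}j(\pi)$, respectively $21\text{-}3\text{-}\cdots\text{-}j(\pi)$, be the number of choices of positions $i_1<i_2<\dots<i_j$ with $i_2=i_1+1$ such that $\pi_{i_1}\pi_{i_2}\cdots\pi_{i_j}$ is in the same relative order as $1\,2\,3\cdots j$, respectively $2\,1\,3\cdots j$ (so for $j=2$ these are the numbers of rises and of descents of $\pi$). Let $$F(t,X,Y)=\sum_{n\ge0}\ \sum_{\pi\in\mathfrak M_n}t^n\prod_{j\ge2}x_j^{\,12\text{-}3\text{-}\cdots\text{-}j(\pi)}\,y_j^{\,21\text{-}3\text{-}\cdots\text{-}j(\pi)},\qquad X=(x_2,x_3,\dots),\ Y=(y_2,y_3,\dots),$$ a formal power series in $t$. Here the $x_j,y_j$ may be arbitrary elements of a field $K$; the case of formal variables is the one where $K$ is the field of rational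 functions in independent indeterminates $x_j,y_j$. Put $X'=(x_2x_3,x_3x_4,\dots)$ and $Y'=(y_2y_3,y_3y_4,\dots)$. Then, in the field $K((t))$ of formal Laurent series, $$F(t,X,Y)=1-\cfrac{t}{ty_2-\cfrac{1}{1+tx_2(1-y_2y_3)+tx_2y_2y_3F(t,X',Y')}},$$ where both denominators are nonzero. Moreover, if all $y_j$ ($j\ge2$) are nonzero (in particular if they are indeterminates), then, with $a_m=\prod_{i=0}^{m}x_{i+2}^{\binom mi}$ and $b_m=\prod_{i=0}^{m}y_{i+2}^{\binom mi}$ for $m\ge0$, $F(t,X,Y)$ is the value of the infinite continued fraction $$1-\cfrac{t}{tb_0-\cfrac{1}{1+ta_0-\cfrac{t^2a_0b_1}{tb_1-\cfrac{1}{1+ta_1-\cfrac{t^2a_1b_2}{tb_2-\cfrac{1}{1+ta_2-\ddots}}}}}}$$ (so $b_0=y_2$, $a_0=x_2$, $b_1=y_2y_3$, $a_1=x_2x_3$, $b_2=y_2y_3^2y_4$, $a_2=x_2x_3^2x_4$, and so on): all its convergents have nonzero denominators, and they converge to $F(t,X,Y)$ in the $t$-adic topology of $K((t))$. -/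

import Mathlib

open scoped PowerSeries LaurentSeries

noncomputable section

/-- A Motzkin permutation of `{0, …, n - 1}`, written as the word `π 0, π 1, …, π (n - 1)`:
it avoids the classical pattern `132`, and it avoids the generalized pattern `1-23`, in which
the letters playing the roles of `2` and `3` have to be adjacent. -/
def IsMotzkin {n : ℕ} (π : Equiv.Perm (Fin n)) : Prop :=
  (∀ a b c : Fin n, a < b → b < c → ¬ (π a < π c ∧ π c < π b)) ∧
  (∀ a b c : Fin n, a < b → (c : ℕ) = b + 1 → ¬ (π a < π b ∧ π b < π c))

/-- `f` gives the positions of an occurrence in `π` of the generalized pattern whose letters are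
`w 0, w 1, …, w (k - 1)` (read up to order isomorphism) and which has no dash
between the letters number `i` and `i + 1` (counted from `0`) exactly when `i ∈ A`. -/
def IsOccurrence {n k : ℕ} (w : Fin k → ℕ) (A : Set ℕ) (π : Equiv.Perm (Fin n))
    (f : Fin k → Fin n) : Prop :=
  StrictMono f ∧
  (∀ a b : Fin k, π (f a) < π (f b) ↔ w a < w b) ∧
  (∀ a b : Fin k, (a : ℕ) ∈ A → (b : ℕ) = a + 1 → (f b : ℕ) = f a + 1)

/-- The number of occurrences of a generalized pattern in `π`. -/
def numOccurrences {n k : ℕ} (w : Fin k → ℕ) (A : Set ℕ) (π : Equiv.Perm (Fin n)) : ℕ :=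
  Set.ncard {f : Fin k → Fin n | IsOccurrence w A π f}

/-- The number of occurrences of `12-3-…-j` in `π`. For `j = 2` the pattern is an
adjacent increasing pair, so this is the number of rises. -/
def occ12 (j : ℕ) {n : ℕ} (π : Equiv.Perm (Fin n)) : ℕ :=
  numOccurrences (fun i : Fin j => (i : ℕ)) {0} π

/-- The number of occurrences of `21-3-…-j` in `π`. For `j = 2` the pattern is an
adjacent decreasing pair, so this is the number of descents. -/
def occ21 (j : ℕ) {n : ℕ} (π : Equiv.Perm (Fin n)) : ℕ :=
  numOccurrences (fun i : Fin j => Equiv.swap 0 1 (i : ℕ)) {0} π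

theorem numOccurrences_eq_zero {n k : ℕ} (h : n < k) (w : Fin k → ℕ) (A : Set ℕ)
    (π : Equiv.Perm (Fin n)) : numOccurrences w A π = 0 := by
  have : {f : Fin k → Fin n | IsOccurrence w A π f} = ∅ := by
    ext f
    simp only [Set.mem_ofPred_eq, Set.mem_empty_iff_false, iff_false]
    intro hf
    have := Fintype.card_le_of_injective f hf.1.injective
    simp at this
    omega
  rw [numOccurrences, this, Set.ncard_empty]

/-- The product of `x_j ^ (12-3-…-j)(π) * y_j ^ (21-3-…-j)(π)` over all `j ≥ 2`; the factors
with `j > n` are all equal to `1` by `numOccurrences_eq_zero`. -/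
def motzkinWeight {R : Type*} [CommRing R] (x y : ℕ → R) {n : ℕ} (π : Equiv.Perm (Fin n)) : R :=
  ∏ j ∈ Finset.Icc 2 n, x j ^ occ12 j π * y j ^ occ21 j π

open Classical in
/-- The generating function `F(t, X, Y)` of Motzkin permutations, as a formal power series in `t`
with `X = (x 2, x 3, …)` and `Y = (y 2, y 3, …)`; the values `x 0, x 1, y 0, y 1` are not used. -/
def motzkinGF {R : Type*} [CommRing R] (x y : ℕ → R) : R⟦X⟧ :=
  PowerSeries.mk fun n =>
    ∑ π ∈ Finset.univ.filter (fun π : Equiv.Perm (Fin n) => IsMotzkin π), motzkinWeight x y π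

/-- The shift `X' = (x_2 x_3, x_3 x_4, …)` of `X = (x_2, x_3, …)`. -/
def shiftVars {R : Type*} [CommRing R] (x : ℕ → R) : ℕ → R := fun j => x j * x (j + 1)

/-- The variable `t` as a Laurent series. -/
def tVar (K : Type*) [Field K] : K⸨X⸩ := ((PowerSeries.X : K⟦X⟧) : K⸨X⸩)

/-- `cfMonomial x m` is `∏_{i = 0}^m x_{i+2} ^ (m choose i)`,
that is `x_2`, `x_2 x_3`, `x_2 x_3^2 x_4`, `x_2 x_3^3 x_4^3 x_5`, … for `m = 0, 1, 2, 3, …`. -/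
def cfMonomial {R : Type*} [CommRing R] (x : ℕ → R) (m : ℕ) : R :=
  ∏ i ∈ Finset.range (m + 1), x (i + 2) ^ m.choose i

/-- The partial numerators of the continued fraction, with their signs: they are
`-t, -1, -t^2 x_2 y_2 y_3, -1, -t^2 x_2 x_3 y_2 y_3^2 y_4, -1, …`. -/
def cfNum {K : Type*} [Field K] (x y : ℕ → K) (k : ℕ) : K⸨X⸩ :=
  if k = 0 then -tVar K
  else if k % 2 = 1 then -1
  else -(tVar K ^ 2 * HahnSeries.C (cfMonomial x (k / 2 - 1) * cfMonomial y (k / 2)))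

/-- The partial denominators of the continued fraction: they are
`t y_2, 1 + t x_2, t y_2 y_3, 1 + t x_2 x_3, t y_2 y_3^2 y_4, 1 + t x_2 x_3^2 x_4, …`. -/
def cfDen {K : Type*} [Field K] (x y : ℕ → K) (k : ℕ) : K⸨X⸩ :=
  if k % 2 = 1 then 1 + tVar K * HahnSeries.C (cfMonomial x (k / 2))
  else tVar K * HahnSeries.C (cfMonomial y (k / 2))

/-- The infinite continued fraction with leading term `1` and the partial numerators and
denominators above. -/
def motzkinCF {K : Type*} [Field K] (x y : ℕ → K) : GenContFract K⸨X⸩ where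
  h := 1
  s := Stream'.Seq.ofStream (fun k => ⟨cfNum x y k, cfDen x y k⟩)

/-- The infinite continued fraction `g` has the value `f`: every convergent has a nonzero
denominator, and the convergents converge to `f` in the `t`-adic topology, i.e. for every `N` the
coefficients below `t^N` of all but finitely many convergents agree with those of `f`. -/
def HasCFValue {K : Type*} [Field K] (g : GenContFract K⸨X⸩) (f : K⸨X⸩) : Prop :=
  (∀ k, g.dens k ≠ 0) ∧
  ∀ N : ℤ, ∀ᶠ k in Filter.atTop, ∀ m : ℤ, m < N → (g.convs k).coeff m = f.coeff m

end

/-! Cut a nonempty Motzkin permutation at its largest letter. Avoiding 132 forces every letter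
before it to exceed every letter after it. Avoiding 1-23 forces the letter just before it to be the
smallest of those before it. So the permutation is `skewSum (addTop σ) τ` with `τ` Motzkin and `σ`
either empty or `skewSum ρ [0]` with `ρ` Motzkin, and conversely.

All patterns in question except 21 end in their largest letter. Their counts are therefore additive
under skew sums, while 21 also sees the junction. An occurrence in `addTop σ` avoids the new letter
or ends in it, which turns the variables into their shifts. With H = `headGF` this gives F = 1 +
tH(1 + y_2(F - 1)) (`motzkinGF_eq`); solving this linear equation gives the finite formula.

Iterating produces tails T_n that are power series with constant term 1 or -1. The errors E_n =
F·B_n - A_n, where A_n/B_n is the n-th convergent, satisfy E_{n+1} = -a_{n+1} E_n / T_{n+1}, so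
their order in t grows by 2 every two steps (`exists_cfError_eq`). The denominators B_n have order 0
or 1 (`exists_dens_eq`), whence convergence. -/

/-! ### Permutations as words of natural numbers -/

/-- The position sequences of the occurrences in the word `l` of the pattern `p 0, …, p (k - 1)`
whose first two letters have to be adjacent. -/
def wordOccSet (p : ℕ → ℕ) (k : ℕ) (l : List ℕ) : Set (Fin k → ℕ) :=
  {f | StrictMono f ∧ (∀ a, f a < l.length) ∧
    (∀ a b, l.getD (f a) 0 < l.getD (f b) 0 ↔ p a < p b) ∧
    (∀ a b : Fin k, (a : ℕ) = 0 → (b : ℕ) = a + 1 → f b = f a + 1)}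

/-- The number of occurrences in a word of a pattern whose first two letters are adjacent. -/
noncomputable def wordOcc (p : ℕ → ℕ) (k : ℕ) (l : List ℕ) : ℕ := (wordOccSet p k l).ncard

theorem wordOccSet_finite (p : ℕ → ℕ) (k : ℕ) (l : List ℕ) : (wordOccSet p k l).Finite := by
  refine Set.Finite.subset (Set.Finite.pi' fun _ : Fin k => Set.finite_Iio l.length) ?_
  rintro f ⟨-, h, -⟩ a
  exact h a

theorem wordOcc_eq_zero {p : ℕ → ℕ} {k : ℕ} {l : List ℕ} (h : l.length < k) :
    wordOcc p k l = 0 := by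
  have : wordOccSet p k l = ∅ := by
    rw [Set.eq_empty_iff_forall_notMem]
    rintro f ⟨hf, hl, -⟩
    have := Fintype.card_le_of_injective (fun a => (⟨f a, hl a⟩ : Fin l.length))
      (fun a b hab => hf.injective (by simpa using hab))
    simp at this
    omega
  rw [wordOcc, this, Set.ncard_empty]

/-- The one-line notation of a permutation. -/
def permWord {n : ℕ} (π : Equiv.Perm (Fin n)) : List ℕ := List.ofFn fun i => (π i : ℕ)

@[simp] theorem length_permWord {n : ℕ} (π : Equiv.Perm (Fin n)) : (permWord π).length = n := by
  simp [permWord]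

theorem getD_permWord {n : ℕ} (π : Equiv.Perm (Fin n)) (i : Fin n) :
    (permWord π).getD i 0 = π i := by
  simp [permWord, List.getD_eq_getElem?_getD]

theorem numOccurrences_eq_wordOcc (p : ℕ → ℕ) (k : ℕ) {n : ℕ} (π : Equiv.Perm (Fin n)) :
    numOccurrences (fun i : Fin k => p i) {0} π = wordOcc p k (permWord π) := by
  have : wordOccSet p k (permWord π) = (fun (f : Fin k → Fin n) a => (f a : ℕ)) ''
      {f | IsOccurrence (fun i : Fin k => p i) {0} π f} := by
    ext f
    constructor
    · rintro ⟨h1, h2, h3, h4⟩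
      simp only [length_permWord] at h2
      refine ⟨fun a => ⟨f a, h2 a⟩, ⟨fun a b hab => h1 hab, fun a b => ?_, fun a b ha hb => ?_⟩, rfl⟩
      · rw [← h3 a b, Fin.lt_def, ← getD_permWord, ← getD_permWord]
      · exact h4 a b ha hb
    · rintro ⟨f, ⟨h1, h2, h3⟩, rfl⟩
      refine ⟨fun a b hab => h1 hab, fun a => by simp, fun a b => ?_, fun a b ha hb => h3 a b ha hb⟩
      rw [getD_permWord, getD_permWord, ← Fin.lt_def, h2]
  rw [numOccurrences, wordOcc, this, Set.ncard_image_of_injective]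
  intro f g hfg
  ext a
  exact congrFun hfg a

/-- `IsWord l` says that `l` is the one-line notation of a permutation of `0, …, l.length - 1`. -/
def IsWord (l : List ℕ) : Prop := l.Nodup ∧ ∀ x ∈ l, x < l.length

theorem IsWord.getD_lt {l : List ℕ} (h : IsWord l) {i : ℕ} (hi : i < l.length) :
    l.getD i 0 < l.length := by
  rw [List.getD_eq_getElem _ _ hi]
  exact h.2 _ (List.getElem_mem hi)

theorem IsWord.mem {l : List ℕ} (h : IsWord l) {x : ℕ} (hx : x < l.length) : x ∈ l := by
  have : l.toFinset = Finset.range l.length := by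
    apply Finset.eq_of_subset_of_card_le
    · intro y hy
      simpa using h.2 y (by simpa using hy)
    · simp [List.toFinset_card_of_nodup h.1]
  rw [← List.mem_toFinset, this]
  simpa using hx

theorem isWord_permWord {n : ℕ} (π : Equiv.Perm (Fin n)) : IsWord (permWord π) := by
  constructor
  · rw [permWord, List.nodup_ofFn]
    exact Fin.val_injective.comp π.injective
  · intro x hx
    simp only [permWord, List.mem_ofFn] at hx
    obtain ⟨i, rfl⟩ := hx
    simp

theorem IsWord.exists_permWord {l : List ℕ} (h : IsWord l) :
    ∃ π : Equiv.Perm (Fin l.length), permWord π = l := by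
  let u : Fin l.length → Fin l.length := fun i => ⟨l.get i, h.2 _ (List.get_mem l i)⟩
  have hu : Function.Injective u := fun i j hij =>
    List.nodup_iff_injective_get.1 h.1 (by simpa [u] using hij)
  refine ⟨Equiv.ofBijective u (Finite.injective_iff_bijective.1 hu), ?_⟩
  simp [permWord, u]

theorem permWord_injective {n : ℕ} : Function.Injective (permWord (n := n)) := by
  intro π ρ h
  have := List.ofFn_injective h
  ext i
  exact congrFun this i

/-- A Motzkin permutation in one-line notation. -/
def MotzkinWord (l : List ℕ) : Prop :=
  (∀ a b c, a < b → b < c → c < l.length →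
    ¬ (l.getD a 0 < l.getD c 0 ∧ l.getD c 0 < l.getD b 0)) ∧
  (∀ a b, a < b → b + 1 < l.length →
    ¬ (l.getD a 0 < l.getD b 0 ∧ l.getD b 0 < l.getD (b + 1) 0))

theorem motzkinWord_permWord {n : ℕ} (π : Equiv.Perm (Fin n)) :
    MotzkinWord (permWord π) ↔ IsMotzkin π := by
  constructor
  · rintro ⟨h1, h2⟩
    refine ⟨fun a b c hab hbc h => h1 a b c hab hbc (by simp) ?_,
      fun a b c hab hbc h => h2 a b hab (by simp [← hbc]) ?_⟩
    · simpa only [getD_permWord, Fin.lt_def] using h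
    · rw [← hbc]
      simpa only [getD_permWord, Fin.lt_def] using h
  · rintro ⟨h1, h2⟩
    refine ⟨fun a b c hab hbc hc h => ?_, fun a b hab hb h => ?_⟩
    · rw [length_permWord] at hc
      refine h1 ⟨a, by omega⟩ ⟨b, by omega⟩ ⟨c, hc⟩ hab hbc ?_
      simpa only [Fin.lt_def, ← getD_permWord] using h
    · rw [length_permWord] at hb
      refine h2 ⟨a, by omega⟩ ⟨b, by omega⟩ ⟨b + 1, hb⟩ hab rfl ?_
      simpa only [Fin.lt_def, ← getD_permWord] using h

/-! ### Skew sums, adjoining a largest letter, and the Motzkin condition -/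

/-- The skew sum: `σ` followed by `τ`, with all letters of `σ` raised above those of `τ`. -/
def skewSum (σ τ : List ℕ) : List ℕ := σ.map (· + τ.length) ++ τ

/-- The word `σ` followed by a new largest letter. -/
def addTop (σ : List ℕ) : List ℕ := σ ++ [σ.length]

@[simp] theorem length_skewSum (σ τ : List ℕ) :
    (skewSum σ τ).length = σ.length + τ.length := by
  simp [skewSum]

@[simp] theorem length_addTop (σ : List ℕ) : (addTop σ).length = σ.length + 1 := by
  simp [addTop]

theorem getD_skewSum_left (σ τ : List ℕ) {i : ℕ} (hi : i < σ.length) :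
    (skewSum σ τ).getD i 0 = σ.getD i 0 + τ.length := by
  rw [skewSum, List.getD_append _ _ _ _ (by simpa using hi),
    List.getD_eq_getElem _ _ (by simpa using hi), List.getD_eq_getElem _ _ hi, List.getElem_map]

theorem getD_skewSum_right (σ τ : List ℕ) (i : ℕ) :
    (skewSum σ τ).getD (σ.length + i) 0 = τ.getD i 0 := by
  rw [skewSum, List.getD_append_right _ _ _ _ (by simp)]
  simp

theorem getD_skewSum_lt {σ τ : List ℕ} (hτ : IsWord τ) {i j : ℕ} (hi : i < σ.length)
    (hj : σ.length ≤ j) (hj' : j < σ.length + τ.length) :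
    (skewSum σ τ).getD j 0 < (skewSum σ τ).getD i 0 := by
  obtain ⟨j, rfl⟩ := Nat.exists_eq_add_of_le hj
  rw [getD_skewSum_right, getD_skewSum_left _ _ hi]
  have := hτ.getD_lt (i := j) (by omega)
  omega

theorem getD_addTop_left (σ : List ℕ) {i : ℕ} (hi : i < σ.length) :
    (addTop σ).getD i 0 = σ.getD i 0 := by
  rw [addTop, List.getD_append _ _ _ _ hi]

theorem getD_addTop_length (σ : List ℕ) : (addTop σ).getD σ.length 0 = σ.length := by
  rw [addTop, List.getD_append_right _ _ _ _ le_rfl]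
  simp

theorem isWord_skewSum {σ τ : List ℕ} (hσ : IsWord σ) (hτ : IsWord τ) :
    IsWord (skewSum σ τ) := by
  constructor
  · rw [skewSum, List.nodup_append]
    refine ⟨hσ.1.map (add_left_injective _), hτ.1, ?_⟩
    intro a ha b hb
    simp only [List.mem_map] at ha
    obtain ⟨c, hc, rfl⟩ := ha
    have := hτ.2 b hb
    omega
  · intro x hx
    rw [length_skewSum]
    rw [skewSum, List.mem_append, List.mem_map] at hx
    rcases hx with ⟨c, hc, rfl⟩ | hx
    · have := hσ.2 c hc
      omega
    · have := hτ.2 x hx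
      omega

theorem isWord_addTop {σ : List ℕ} (hσ : IsWord σ) : IsWord (addTop σ) := by
  constructor
  · rw [addTop, List.nodup_append]
    refine ⟨hσ.1, by simp, ?_⟩
    intro a ha b hb
    have := hσ.2 a ha
    simp at hb
    omega
  · intro x hx
    rw [length_addTop]
    rw [addTop, List.mem_append] at hx
    rcases hx with hx | hx
    · have := hσ.2 x hx
      omega
    · simp at hx
      omega

/-- Both forbidden patterns start with their smallest letter, so an occurrence starting in `σ`
cannot reach the lower letters of `τ`. -/
theorem motzkinWord_skewSum {σ τ : List ℕ} (hτ : IsWord τ) :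
    MotzkinWord (skewSum σ τ) ↔ MotzkinWord σ ∧ MotzkinWord τ := by
  constructor
  · rintro ⟨h1, h2⟩
    rw [length_skewSum] at h1 h2
    refine ⟨⟨fun a b c hab hbc hc h => h1 a b c hab hbc (by omega) ?_,
      fun a b hab hb h => h2 a b hab (by omega) ?_⟩,
      ⟨fun a b c hab hbc hc h => h1 (σ.length + a) (σ.length + b) (σ.length + c) (by omega)
        (by omega) (by omega) ?_, fun a b hab hb h => h2 (σ.length + a) (σ.length + b) (by omega)
        (by omega) ?_⟩⟩
    · rw [getD_skewSum_left _ _ (by omega), getD_skewSum_left _ _ (by omega),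
        getD_skewSum_left _ _ (by omega)]
      omega
    · rw [getD_skewSum_left _ _ (by omega), getD_skewSum_left _ _ (by omega),
        getD_skewSum_left _ _ (by omega)]
      omega
    · simpa only [getD_skewSum_right] using h
    · simpa only [add_assoc, getD_skewSum_right] using h
  · rintro ⟨⟨h1, h2⟩, h3, h4⟩
    refine ⟨fun a b c hab hbc hc h => ?_, fun a b hab hb h => ?_⟩
    · rw [length_skewSum] at hc
      by_cases ha : a < σ.length
      · by_cases hc' : c < σ.length
        · rw [getD_skewSum_left _ _ (by omega), getD_skewSum_left _ _ (by omega),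
            getD_skewSum_left _ _ (by omega)] at h
          exact h1 a b c hab hbc hc' (by omega)
        · have := getD_skewSum_lt (σ := σ) hτ ha (by omega : σ.length ≤ c) hc
          omega
      · obtain ⟨a, rfl⟩ := Nat.exists_eq_add_of_le (not_lt.1 ha)
        obtain ⟨b, rfl⟩ := Nat.exists_eq_add_of_le (by omega : σ.length ≤ b)
        obtain ⟨c, rfl⟩ := Nat.exists_eq_add_of_le (by omega : σ.length ≤ c)
        simp only [getD_skewSum_right] at h
        exact h3 a b c (by omega) (by omega) (by omega) h
    · rw [length_skewSum] at hb
      by_cases ha : a < σ.length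
      · by_cases hb' : b + 1 < σ.length
        · rw [getD_skewSum_left _ _ (by omega), getD_skewSum_left _ _ (by omega),
            getD_skewSum_left _ _ (by omega)] at h
          exact h2 a b hab hb' (by omega)
        · have := getD_skewSum_lt (σ := σ) hτ ha (by omega : σ.length ≤ b + 1) hb
          omega
      · obtain ⟨a, rfl⟩ := Nat.exists_eq_add_of_le (not_lt.1 ha)
        obtain ⟨b, rfl⟩ := Nat.exists_eq_add_of_le (by omega : σ.length ≤ b)
        simp only [add_assoc, getD_skewSum_right] at h
        exact h4 a b (by omega) (by omega) h

/-- The new letter is last and largest, so it can only be the 3 of a 1-23, whose 2 is then the last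
letter of `σ`. -/
theorem motzkinWord_addTop {σ : List ℕ} (hσ : IsWord σ) :
    MotzkinWord (addTop σ) ↔ MotzkinWord σ ∧
      ∀ a, a + 1 < σ.length → σ.getD (σ.length - 1) 0 ≤ σ.getD a 0 := by
  constructor
  · rintro ⟨h1, h2⟩
    rw [length_addTop] at h1 h2
    refine ⟨⟨fun a b c hab hbc hc h => h1 a b c hab hbc (by omega) ?_,
      fun a b hab hb h => h2 a b hab (by omega) ?_⟩, fun a ha => ?_⟩
    · rwa [getD_addTop_left _ (by omega), getD_addTop_left _ (by omega),
        getD_addTop_left _ (by omega)]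
    · rwa [getD_addTop_left _ (by omega), getD_addTop_left _ (by omega),
        getD_addTop_left _ (by omega)]
    · have := h2 a (σ.length - 1) (by omega) (by omega)
      rw [Nat.sub_add_cancel (by omega), getD_addTop_left _ (by omega),
        getD_addTop_left _ (by omega), getD_addTop_length] at this
      have := hσ.getD_lt (i := σ.length - 1) (by omega)
      omega
  · rintro ⟨⟨h1, h2⟩, h3⟩
    refine ⟨fun a b c hab hbc hc h => ?_, fun a b hab hb h => ?_⟩
    · rw [length_addTop] at hc
      rw [getD_addTop_left _ (by omega), getD_addTop_left _ (i := b) (by omega)] at h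
      rcases Nat.lt_succ_iff_lt_or_eq.1 hc with hc | rfl
      · rw [getD_addTop_left _ hc] at h
        exact h1 a b c hab hbc hc h
      · rw [getD_addTop_length] at h
        have := hσ.getD_lt hbc
        omega
    · rw [length_addTop] at hb
      rw [getD_addTop_left _ (by omega), getD_addTop_left _ (i := b) (by omega)] at h
      rcases Nat.lt_succ_iff_lt_or_eq.1 hb with hb | hb
      · rw [getD_addTop_left _ hb] at h
        exact h2 a b hab hb h
      · have := h3 a (by omega)
        rw [← hb, Nat.add_sub_cancel] at this
        omega

theorem motzkinWord_nil : MotzkinWord [] :=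
  ⟨fun _ _ _ _ _ h => absurd h (by simp), fun _ _ _ h => absurd h (by simp)⟩

theorem isWord_nil : IsWord [] := ⟨by simp, by simp⟩

theorem motzkinWord_singleton : MotzkinWord [0] :=
  ⟨fun a b c h h' h'' => by simp at h''; omega, fun a b h h' => by simp at h'⟩

theorem isWord_singleton : IsWord [0] := ⟨by simp, by simp⟩

/-! ### Pattern counts under the two constructions -/

/-- By `hp` the pattern ends in its largest letter. An occurrence ending in `τ` can thus use no
letter of `σ`, and one ending in `σ` lies in `σ`. -/
theorem wordOcc_skewSum {p : ℕ → ℕ} {k : ℕ} (hp : ∀ a, a < k → p a < p k) {σ τ : List ℕ}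
    (hτ : IsWord τ) :
    wordOcc p (k + 1) (skewSum σ τ) = wordOcc p (k + 1) σ + wordOcc p (k + 1) τ := by
  have key : wordOccSet p (k + 1) (skewSum σ τ) = wordOccSet p (k + 1) σ ∪
      (fun f a => σ.length + f a) '' wordOccSet p (k + 1) τ := by
    ext f
    constructor
    · rintro ⟨h1, h2, h3, h4⟩
      simp only [length_skewSum] at h2
      by_cases hl : f (Fin.last k) < σ.length
      · have hlt : ∀ a, f a < σ.length := fun a =>
          lt_of_le_of_lt (h1.monotone (Fin.le_last a)) hl
        refine Or.inl ⟨h1, hlt, fun a b => ?_, h4⟩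
        rw [← h3, getD_skewSum_left _ _ (hlt a), getD_skewSum_left _ _ (hlt b)]
        omega
      · have hge : ∀ a, σ.length ≤ f a := by
          intro a
          by_contra ha
          have hak : (a : ℕ) < k := by
            refine lt_of_le_of_ne (Fin.is_le a) fun h => ?_
            have : a = Fin.last k := Fin.ext h
            rw [this] at ha
            exact ha (not_lt.1 hl)
          have := (h3 a (Fin.last k)).2 (hp a hak)
          have := getD_skewSum_lt hτ (not_le.1 ha) (not_lt.1 hl) (h2 _)
          omega
        have hf : ∀ a, σ.length + (f a - σ.length) = f a := fun a => Nat.add_sub_cancel' (hge a)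
        refine Or.inr ⟨fun a => f a - σ.length, ⟨fun a b hab => ?_, fun a => ?_, fun a b => ?_,
          fun a b ha hb => ?_⟩, funext hf⟩
        · have := h1 hab
          have := hge a
          show f a - σ.length < f b - σ.length
          omega
        · have := h2 a
          have := hge a
          show f a - σ.length < _
          omega
        · rw [← h3, ← getD_skewSum_right σ τ, ← getD_skewSum_right σ τ, hf, hf]
        · have := h4 a b ha hb
          have := hge a
          show f b - σ.length = f a - σ.length + 1
          omega
    · rintro (⟨h1, h2, h3, h4⟩ | ⟨f, ⟨h1, h2, h3, h4⟩, rfl⟩)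
      · refine ⟨h1, fun a => ?_, fun a b => ?_, h4⟩
        · rw [length_skewSum]
          exact Nat.lt_add_right _ (h2 a)
        · rw [← h3, getD_skewSum_left _ _ (h2 a), getD_skewSum_left _ _ (h2 b)]
          omega
      · refine ⟨fun a b hab => Nat.add_lt_add_left (h1 hab) _, fun a => ?_, fun a b => ?_,
          fun a b ha hb => ?_⟩
        · rw [length_skewSum]
          exact Nat.add_lt_add_left (h2 a) _
        · rw [← h3, getD_skewSum_right, getD_skewSum_right]
        · show σ.length + f b = σ.length + f a + 1
          rw [h4 a b ha hb, add_assoc]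
  rw [wordOcc, key, Set.ncard_union_eq ?_ (wordOccSet_finite _ _ _)
    ((wordOccSet_finite _ _ _).image _), Set.ncard_image_of_injective, wordOcc, wordOcc]
  · intro f g hfg
    funext a
    exact Nat.add_left_cancel (congrFun hfg a)
  · rw [Set.disjoint_left]
    rintro _ ⟨-, h, -⟩ ⟨f, -, rfl⟩
    have := h 0
    simp at this

/-- Occurrences using the new letter end in it, and deleting it leaves an occurrence of the pattern
of length `k`. Since `2 ≤ k`, the adjacency condition does not involve the deleted letter. -/
theorem wordOcc_addTop {p : ℕ → ℕ} {k : ℕ} (hk : 2 ≤ k) (hp : ∀ a, a < k → p a < p k)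
    {σ : List ℕ} (hσ : IsWord σ) :
    wordOcc p (k + 1) (addTop σ) = wordOcc p (k + 1) σ + wordOcc p k σ := by
  have key : wordOccSet p (k + 1) (addTop σ) = wordOccSet p (k + 1) σ ∪
      (fun f : Fin k → ℕ => (Fin.snoc f σ.length : Fin (k + 1) → ℕ)) '' wordOccSet p k σ := by
    ext f
    constructor
    · rintro ⟨h1, h2, h3, h4⟩
      simp only [length_addTop] at h2
      by_cases hl : f (Fin.last k) < σ.length
      · have hlt : ∀ a, f a < σ.length := fun a =>
          lt_of_le_of_lt (h1.monotone (Fin.le_last a)) hl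
        refine Or.inl ⟨h1, hlt, fun a b => ?_, h4⟩
        rw [← h3, getD_addTop_left _ (hlt a), getD_addTop_left _ (hlt b)]
      · have hl' : f (Fin.last k) = σ.length := by
          have := h2 (Fin.last k)
          omega
        have hlt : ∀ a : Fin k, f a.castSucc < σ.length := fun a => by
          rw [← hl']
          exact h1 (Fin.castSucc_lt_last a)
        refine Or.inr ⟨fun a => f a.castSucc, ⟨fun a b hab => h1 (by simpa using hab), hlt,
          fun a b => ?_, fun a b ha hb => h4 a.castSucc b.castSucc (by simpa using ha)
          (by simpa using hb)⟩, ?_⟩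
        · have := h3 a.castSucc b.castSucc
          rwa [getD_addTop_left _ (hlt a), getD_addTop_left _ (hlt b)] at this
        · funext a
          refine Fin.lastCases ?_ (fun a => ?_) a
          · simp [hl']
          · simp
    · rintro (⟨h1, h2, h3, h4⟩ | ⟨f, ⟨h1, h2, h3, h4⟩, rfl⟩)
      · refine ⟨h1, fun a => ?_, fun a b => ?_, h4⟩
        · rw [length_addTop]
          exact Nat.lt_succ_of_lt (h2 a)
        · rw [← h3, getD_addTop_left _ (h2 a), getD_addTop_left _ (h2 b)]
      · refine ⟨fun a b => ?_, fun a => ?_, fun a b => ?_, fun a b => ?_⟩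
        · refine Fin.lastCases ?_ (fun b => ?_) b
          · refine Fin.lastCases ?_ (fun a => ?_) a
            · simp
            · simp [h2]
          · refine Fin.lastCases ?_ (fun a => ?_) a
            · intro h
              exact absurd h (Fin.castSucc_lt_last b).not_gt
            · simpa using fun h => h1 h
        · refine Fin.lastCases ?_ (fun a => ?_) a
          · simp
          · simpa using Nat.lt_succ_of_lt (h2 a)
        · refine Fin.lastCases ?_ (fun b => ?_) b
          · refine Fin.lastCases ?_ (fun a => ?_) a
            · simp
            · simp only [Fin.snoc_castSucc, Fin.snoc_last, getD_addTop_length,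
                getD_addTop_left _ (h2 a), hσ.getD_lt (h2 a), Fin.val_castSucc, Fin.val_last,
                hp a a.2]
          · refine Fin.lastCases ?_ (fun a => ?_) a
            · simp only [Fin.snoc_castSucc, Fin.snoc_last, getD_addTop_length,
                getD_addTop_left _ (h2 b), Fin.val_castSucc, Fin.val_last,
                (hp b b.2).not_gt, (hσ.getD_lt (h2 b)).not_gt]
            · simp only [Fin.snoc_castSucc, getD_addTop_left _ (h2 a), getD_addTop_left _ (h2 b),
                h3, Fin.val_castSucc]
        · refine Fin.lastCases ?_ (fun b => ?_) b
          · intro ha hb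
            rw [Fin.val_last] at hb
            omega
          · refine Fin.lastCases ?_ (fun a => ?_) a
            · intro ha
              rw [Fin.val_last] at ha
              omega
            · simpa using h4 a b
  rw [wordOcc, key, Set.ncard_union_eq ?_ (wordOccSet_finite _ _ _)
    ((wordOccSet_finite _ _ _).image _), Set.ncard_image_of_injective, wordOcc, wordOcc]
  · intro f g hfg
    exact (Fin.snoc_inj.1 hfg).1
  · rw [Set.disjoint_left]
    rintro _ ⟨-, h, -⟩ ⟨f, -, rfl⟩
    have := h (Fin.last k)
    simp at this

theorem wordOcc_two (p : ℕ → ℕ) (l : List ℕ) :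
    wordOcc p 2 l = ((Finset.range (l.length - 1)).filter fun i =>
      (l.getD i 0 < l.getD (i + 1) 0 ↔ p 0 < p 1) ∧
      (l.getD (i + 1) 0 < l.getD i 0 ↔ p 1 < p 0)).card := by
  have key : wordOccSet p 2 l = (fun i => ![i, i + 1]) '' ((Finset.range (l.length - 1)).filter
      fun i => (l.getD i 0 < l.getD (i + 1) 0 ↔ p 0 < p 1) ∧
      (l.getD (i + 1) 0 < l.getD i 0 ↔ p 1 < p 0) : Finset ℕ) := by
    ext f
    constructor
    · rintro ⟨h1, h2, h3, h4⟩
      have h5 : f 1 = f 0 + 1 := h4 0 1 rfl rfl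
      refine ⟨f 0, ?_, ?_⟩
      · have h6 := h3 0 1
        have h7 := h3 1 0
        rw [h5] at h6 h7
        have := h2 1
        simp only [Finset.coe_filter, Finset.mem_range, Set.mem_ofPred_eq]
        exact ⟨by omega, h6, h7⟩
      · funext a
        fin_cases a
        · rfl
        · exact h5.symm
    · rintro ⟨i, hi, rfl⟩
      simp only [Finset.coe_filter, Finset.mem_range, Set.mem_ofPred_eq] at hi
      obtain ⟨hi, h1, h2⟩ := hi
      refine ⟨?_, ?_, ?_, ?_⟩
      · simp [Fin.strictMono_iff_lt_succ]
      · simp only [Fin.forall_fin_two, Matrix.cons_val_zero, Matrix.cons_val_one]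
        omega
      · simp only [Fin.forall_fin_two, Matrix.cons_val_zero, Matrix.cons_val_one]
        exact ⟨⟨by simp, h1⟩, h2, by simp⟩
      · simp [Fin.forall_fin_two]
  rw [wordOcc, key, Set.ncard_image_of_injective, Set.ncard_coe_finset]
  intro i j hij
  exact congrFun hij 0

/-- The number of descents. -/
theorem wordOcc_two_desc {p : ℕ → ℕ} (hp : p 1 < p 0) {l : List ℕ} :
    wordOcc p 2 l = ∑ i ∈ Finset.range (l.length - 1),
      if l.getD (i + 1) 0 < l.getD i 0 then 1 else 0 := by
  rw [wordOcc_two, Finset.card_filter]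
  refine Finset.sum_congr rfl fun i _ => ?_
  congr 1
  simp only [hp, hp.not_gt, iff_true, iff_false, eq_iff_iff]
  omega

/-- The number of rises. -/
theorem wordOcc_two_rise {p : ℕ → ℕ} (hp : p 0 < p 1) {l : List ℕ} :
    wordOcc p 2 l = ∑ i ∈ Finset.range (l.length - 1),
      if l.getD i 0 < l.getD (i + 1) 0 then 1 else 0 := by
  rw [wordOcc_two, Finset.card_filter]
  refine Finset.sum_congr rfl fun i _ => ?_
  congr 1
  simp only [hp, hp.not_gt, iff_true, iff_false, eq_iff_iff]
  omega

theorem wordOcc_two_rise_addTop {p : ℕ → ℕ} (hp : p 0 < p 1) {σ : List ℕ} (hσ : IsWord σ) :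
    wordOcc p 2 (addTop σ) = wordOcc p 2 σ + if σ = [] then 0 else 1 := by
  rw [wordOcc_two_rise hp, wordOcc_two_rise hp, length_addTop, Nat.add_sub_cancel]
  rcases hn : σ.length with _ | n
  · simp [List.length_eq_zero_iff.1 hn]
  · rw [Finset.sum_range_succ, Nat.add_sub_cancel]
    have : σ ≠ [] := by rintro rfl; simp at hn
    rw [← hn, getD_addTop_length, getD_addTop_left _ (by omega),
      if_pos (hσ.getD_lt (by omega)), if_neg this]
    congr 1
    refine Finset.sum_congr rfl fun i hi => ?_
    have := Finset.mem_range.1 hi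
    rw [getD_addTop_left _ (by omega), getD_addTop_left _ (by omega)]

theorem wordOcc_two_desc_addTop {p : ℕ → ℕ} (hp : p 1 < p 0) {σ : List ℕ} (hσ : IsWord σ) :
    wordOcc p 2 (addTop σ) = wordOcc p 2 σ := by
  rw [wordOcc_two_desc hp, wordOcc_two_desc hp, length_addTop, Nat.add_sub_cancel]
  rcases hn : σ.length with _ | n
  · simp
  · rw [Finset.sum_range_succ, Nat.add_sub_cancel]
    rw [← hn, getD_addTop_length, getD_addTop_left _ (by omega),
      if_neg (hσ.getD_lt (by omega)).not_gt, add_zero]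
    refine Finset.sum_congr rfl fun i hi => ?_
    have := Finset.mem_range.1 hi
    rw [getD_addTop_left _ (by omega), getD_addTop_left _ (by omega)]

theorem wordOcc_two_desc_skewSum {p : ℕ → ℕ} (hp : p 1 < p 0) {σ τ : List ℕ} (hτ : IsWord τ) :
    wordOcc p 2 (skewSum σ τ) =
      wordOcc p 2 σ + wordOcc p 2 τ + if σ = [] ∨ τ = [] then 0 else 1 := by
  rcases List.eq_nil_or_concat' σ with rfl | ⟨σ', s, hσ⟩
  · simp [skewSum, wordOcc_two_desc hp]
  rcases hτl : τ with _ | ⟨t, τ'⟩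
  · simp [skewSum, wordOcc_two_desc hp]
  have h1 : σ.length = σ'.length + 1 := by simp [hσ]
  have h2 : τ.length = τ'.length + 1 := by simp [hτl]
  -- The adjacent pairs split into those inside `σ`, the junction, which is always a descent, and
  -- those inside `τ`.
  rw [← hτl, if_neg (by simp [hσ, hτl]), wordOcc_two_desc hp, wordOcc_two_desc hp,
    wordOcc_two_desc hp, length_skewSum,
    show σ.length + τ.length - 1 = (σ.length - 1) + 1 + (τ.length - 1) by omega,
    Finset.sum_range_add, Finset.sum_range_succ,
    show σ.length - 1 + 1 = σ.length by omega,
    if_pos (getD_skewSum_lt hτ (by omega) le_rfl (by omega)), add_right_comm]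
  congr 2
  · refine Finset.sum_congr rfl fun i hi => ?_
    have := Finset.mem_range.1 hi
    rw [getD_skewSum_left _ _ (by omega), getD_skewSum_left _ _ (by omega)]
    simp
  · refine Finset.sum_congr rfl fun i hi => ?_
    rw [add_assoc, getD_skewSum_right, getD_skewSum_right]

/-! ### Decomposition of Motzkin words at the largest letter -/

theorem IsWord.eq_skewSum {s t : List ℕ} (h : IsWord (s ++ t))
    (hst : ∀ a ∈ s, ∀ b ∈ t, b < a) :
    ∃ σ, IsWord σ ∧ IsWord t ∧ s = σ.map (· + t.length) := by
  obtain ⟨hnd, hlt⟩ := h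
  rw [List.nodup_append] at hnd
  have ht : IsWord t := by
    refine ⟨hnd.2.1, fun b hb => ?_⟩
    -- The letters of `t` are closed downwards, so `t` has at least `b + 1` letters.
    have hsub : Finset.range (b + 1) ⊆ t.toFinset := by
      intro c hc
      have hcb : c ≤ b := Nat.lt_succ_iff.1 (Finset.mem_range.1 hc)
      have hcm : c ∈ s ++ t := by
        have hb' := hlt b (List.mem_append_right _ hb)
        refine IsWord.mem ⟨?_, hlt⟩ (lt_of_le_of_lt hcb hb')
        rw [List.nodup_append]
        exact hnd
      rcases List.mem_append.1 hcm with hcs | hct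
      · exact absurd (hst c hcs b hb) (not_lt.2 hcb)
      · simpa using hct
    have := Finset.card_le_card hsub
    rw [Finset.card_range, List.toFinset_card_of_nodup hnd.2.1] at this
    exact this
  have hge : ∀ a ∈ s, t.length ≤ a := by
    intro a ha
    by_contra hlt'
    exact hnd.2.2 a ha a (ht.mem (not_le.1 hlt')) rfl
  have hs : s = (s.map (· - t.length)).map (· + t.length) := by
    rw [List.map_map]
    refine (List.map_id s).symm.trans (List.map_congr_left fun a ha => ?_)
    exact (Nat.sub_add_cancel (hge a ha)).symm
  refine ⟨s.map (· - t.length), ⟨?_, ?_⟩, ht, hs⟩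
  · have := hnd.1
    rw [hs] at this
    exact this.of_map _
  · intro x hx
    rw [List.mem_map] at hx
    obtain ⟨a, ha, rfl⟩ := hx
    have h1 := hlt a (List.mem_append_left _ ha)
    have h2 := hge a ha
    rw [List.length_append] at h1
    rw [List.length_map]
    omega

theorem isWord_of_addTop {σ : List ℕ} (h : IsWord (addTop σ)) : IsWord σ := by
  obtain ⟨h1, h2⟩ := h
  rw [addTop, List.nodup_append] at h1
  refine ⟨h1.1, fun x hx => ?_⟩
  have h3 := h2 x (List.mem_append_left _ hx)
  have h4 := h1.2.2 x hx σ.length (by simp)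
  rw [length_addTop] at h3
  omega

open Classical in
/-- The Motzkin permutations of length `n` in one-line notation. -/
noncomputable def motzkinWords (n : ℕ) : Finset (List ℕ) :=
  (Finset.univ.filter fun π : Equiv.Perm (Fin n) => IsMotzkin π).image permWord

theorem mem_motzkinWords {n : ℕ} {l : List ℕ} :
    l ∈ motzkinWords n ↔ l.length = n ∧ IsWord l ∧ MotzkinWord l := by
  simp only [motzkinWords, Finset.mem_image, Finset.mem_filter, Finset.mem_univ, true_and]
  constructor
  · rintro ⟨π, hπ, rfl⟩
    exact ⟨length_permWord π, isWord_permWord π, (motzkinWord_permWord π).2 hπ⟩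
  · rintro ⟨rfl, h1, h2⟩
    obtain ⟨π, hπ⟩ := h1.exists_permWord
    exact ⟨π, (motzkinWord_permWord π).1 (hπ.symm ▸ h2), hπ⟩

theorem motzkinWords_zero : motzkinWords 0 = {[]} := by
  ext l
  rw [mem_motzkinWords, Finset.mem_singleton, List.length_eq_zero_iff]
  exact ⟨fun h => h.1, by rintro rfl; exact ⟨rfl, isWord_nil, motzkinWord_nil⟩⟩

/-- The words of length `k` that can precede the largest letter of a Motzkin permutation,
up to order isomorphism. -/
noncomputable def motzkinHeads : ℕ → Finset (List ℕ)
  | 0 => {[]}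
  | k + 1 => (motzkinWords k).image fun ρ => skewSum ρ [0]

/-- By `motzkinWord_addTop` the last letter of a nonempty head is its minimum 0; splitting it off is
a skew sum with `[0]`. -/
theorem mem_motzkinHeads {k : ℕ} {σ : List ℕ} :
    σ ∈ motzkinHeads k ↔ σ.length = k ∧ IsWord σ ∧ MotzkinWord (addTop σ) := by
  rcases k with _ | k
  · rw [motzkinHeads, Finset.mem_singleton, List.length_eq_zero_iff]
    exact ⟨by rintro rfl; exact ⟨rfl, isWord_nil, motzkinWord_singleton⟩, fun h => h.1⟩
  · simp only [motzkinHeads, Finset.mem_image, mem_motzkinWords]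
    constructor
    · rintro ⟨ρ, ⟨rfl, h1, h2⟩, rfl⟩
      have h3 := isWord_skewSum h1 isWord_singleton
      refine ⟨by simp, h3, (motzkinWord_addTop h3).2
        ⟨(motzkinWord_skewSum isWord_singleton).2 ⟨h2, motzkinWord_singleton⟩, fun a _ => ?_⟩⟩
      have := getD_skewSum_right ρ [0] 0
      rw [length_skewSum, List.length_singleton, Nat.add_sub_cancel]
      rw [add_zero] at this
      rw [this]
      exact Nat.zero_le _
    · rintro ⟨h1, h2, h3⟩
      obtain ⟨h4, h5⟩ := (motzkinWord_addTop h2).1 h3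
      rcases List.eq_nil_or_concat' σ with rfl | ⟨s, m, rfl⟩
      · simp at h1
      · obtain ⟨ρ, h6, h7, h8⟩ := IsWord.eq_skewSum h2 (by
          intro a ha b hb
          rw [List.mem_singleton] at hb
          subst hb
          obtain ⟨i, hi, rfl⟩ := List.getElem_of_mem ha
          have := h5 i (by simpa using hi)
          rw [List.getD_append _ _ _ _ hi, List.getD_eq_getElem _ _ hi,
            List.getD_append_right _ _ _ _ (by simp)] at this
          simp at this
          have hne := (List.nodup_append.1 h2.1).2.2 s[i] ha b (by simp)
          omega)
        have hm : m = 0 := by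
          have := h7.2 m (by simp)
          simpa using this
        subst hm
        have h9 : s ++ [0] = skewSum ρ [0] := by rw [skewSum, ← h8]
        rw [h9] at h4
        refine ⟨ρ, ⟨?_, h6, ((motzkinWord_skewSum isWord_singleton).1 h4).1⟩, h9.symm⟩
        rw [h9] at h1
        simpa using h1

/-- The largest letter occurs only once and its position is the length of `σ`, so the cut is
determined by the word. -/
theorem skewSum_addTop_eq {σ τ σ' τ' : List ℕ} (hσ : IsWord σ) (hτ : IsWord τ)
    (hn : σ.length + τ.length = σ'.length + τ'.length)
    (h : skewSum (addTop σ) τ = skewSum (addTop σ') τ') : σ = σ' ∧ τ = τ' := by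
  have hw := isWord_skewSum (isWord_addTop hσ) hτ
  have h1 : (skewSum (addTop σ) τ).getD σ.length 0 = σ.length + τ.length := by
    rw [getD_skewSum_left _ _ (by simp), getD_addTop_length]
  have h2 : (skewSum (addTop σ) τ).getD σ'.length 0 = σ'.length + τ'.length := by
    rw [h, getD_skewSum_left _ _ (by simp), getD_addTop_length]
  have h3 : σ.length < (skewSum (addTop σ) τ).length := by simp; omega
  have h4 : σ'.length < (skewSum (addTop σ) τ).length := by simp; omega
  rw [List.getD_eq_getElem _ _ h3] at h1
  rw [List.getD_eq_getElem _ _ h4] at h2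
  have h5 : σ.length = σ'.length :=
    (hw.1.getElem_inj_iff (hi := h3) (hj := h4)).1 (by rw [h1, h2, hn])
  obtain ⟨h6, rfl⟩ := List.append_inj' h (by omega)
  have h7 := List.map_injective_iff.2 (add_left_injective _) h6
  exact ⟨(List.append_inj h7 h5).1, rfl⟩

theorem exists_skewSum_addTop {n : ℕ} {l : List ℕ} (hl : l ∈ motzkinWords (n + 1)) :
    ∃ σ τ, skewSum (addTop σ) τ = l ∧ σ.length + τ.length = n ∧ σ ∈ motzkinHeads σ.length ∧
      τ ∈ motzkinWords τ.length := by
  obtain ⟨h1, h2, h3⟩ := mem_motzkinWords.1 hl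
  obtain ⟨s, τ, rfl⟩ := List.append_of_mem (h2.mem (x := n) (by omega))
  have h4 : s ++ n :: τ = (s ++ [n]) ++ τ := by simp
  rw [h4] at h1 h2 h3 ⊢
  obtain ⟨σ, h5, h6, h7⟩ := IsWord.eq_skewSum h2 (by
    have hnd := List.nodup_append.1 h2.1
    have hnd' := List.nodup_append.1 hnd.1
    intro a ha b hb
    have hbn : b < n := by
      have h8 := h2.2 b (List.mem_append_right _ hb)
      have h9 := hnd.2.2 n (by simp) b hb
      omega
    rcases List.mem_append.1 ha with ha' | ha'
    · obtain ⟨i, hi, rfl⟩ := List.getElem_of_mem ha'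
      obtain ⟨j, hj, rfl⟩ := List.getElem_of_mem hb
      have h8 := hnd.2.2 _ ha _ hb
      -- Avoidance of 132 with `n` as the 3: a letter before `n` cannot be smaller than a letter
      -- after it.
      have h9 := h3.1 i s.length (s.length + 1 + j) hi (by omega) (by simp; omega)
      rw [List.getD_append _ _ _ _ (by simp; omega), List.getD_append _ _ _ _ hi,
        List.getD_eq_getElem _ _ hi, List.getD_append_right _ _ _ _ (by simp),
        List.getD_append _ _ _ _ (by simp), List.getD_append_right _ _ _ _ le_rfl] at h9
      simp only [List.length_append, List.length_singleton, Nat.add_sub_cancel_left,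
        Nat.sub_self, List.getD_cons_zero, List.getD_eq_getElem _ _ hj] at h9
      omega
    · rw [List.mem_singleton] at ha'
      omega)
  rcases List.eq_nil_or_concat' σ with rfl | ⟨σ, c, rfl⟩
  · simp at h7
  rw [List.map_append] at h7
  obtain ⟨h8, h9⟩ := List.append_inj' h7 (by simp)
  have h10 : n = c + τ.length := by simpa using h9
  have h11 : s.length = σ.length := by rw [h8, List.length_map]
  have h12 : c = σ.length := by
    simp only [List.length_append, List.length_singleton] at h1
    omega
  subst h12
  have h13 : s ++ [n] ++ τ = skewSum (addTop σ) τ := by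
    rw [h7, skewSum, addTop, List.map_append]
  rw [h13] at h3
  have h14 := (motzkinWord_skewSum h6).1 h3
  exact ⟨σ, τ, h13.symm, h10.symm, mem_motzkinHeads.2 ⟨rfl, isWord_of_addTop h5, h14.1⟩,
    mem_motzkinWords.2 ⟨rfl, h6, h14.2⟩⟩

theorem sum_motzkinWords_succ {R : Type*} [CommRing R] (f : List ℕ → R) (n : ℕ) :
    ∑ l ∈ motzkinWords (n + 1), f l = ∑ kl ∈ Finset.HasAntidiagonal.antidiagonal n,
      ∑ στ ∈ motzkinHeads kl.1 ×ˢ motzkinWords kl.2, f (skewSum (addTop στ.1) στ.2) := by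
  rw [Finset.sum_sigma']
  symm
  refine Finset.sum_bij (fun z _ => skewSum (addTop z.2.1) z.2.2) ?_ ?_ ?_ (fun _ _ => rfl)
  · rintro ⟨⟨k, l⟩, σ, τ⟩ h
    simp only [Finset.mem_sigma, Finset.HasAntidiagonal.mem_antidiagonal, Finset.mem_product, mem_motzkinHeads,
      mem_motzkinWords] at h ⊢
    obtain ⟨rfl, ⟨rfl, h1, h2⟩, rfl, h3, h4⟩ := h
    exact ⟨by simp; omega, isWord_skewSum (isWord_addTop h1) h3,
      (motzkinWord_skewSum h3).2 ⟨h2, h4⟩⟩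
  · rintro ⟨⟨k, l⟩, σ, τ⟩ h ⟨⟨k', l'⟩, σ', τ'⟩ h' heq
    simp only [Finset.mem_sigma, Finset.HasAntidiagonal.mem_antidiagonal, Finset.mem_product, mem_motzkinHeads,
      mem_motzkinWords] at h h'
    obtain ⟨h0, ⟨rfl, h1, -⟩, rfl, h3, -⟩ := h
    obtain ⟨h0', ⟨rfl, -, -⟩, rfl, -, -⟩ := h'
    obtain ⟨rfl, rfl⟩ := skewSum_addTop_eq h1 h3 (h0.trans h0'.symm) heq
    rfl
  · intro l hl
    obtain ⟨σ, τ, h1, h2, h3, h4⟩ := exists_skewSum_addTop hl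
    refine ⟨⟨(σ.length, τ.length), σ, τ⟩, ?_, h1⟩
    simp [h2, h3, h4]

/-! ### Weights of words -/

/-- The contribution of one family of patterns to the weight of a word. -/
noncomputable def patternWeight {R : Type*} [CommRing R] (p : ℕ → ℕ) (x : ℕ → R) (l : List ℕ) :
    R :=
  ∏ i ∈ Finset.range l.length, x (i + 2) ^ wordOcc p (i + 2) l

section Weight

variable {R : Type*} [CommRing R]

/-- The factor number `i` belongs to a pattern of length `i + 2`, so factors with `i + 1 ≥ l.length`
are trivial. This lets words of different lengths share one index range. -/
theorem prod_range_eq_patternWeight (p : ℕ → ℕ) (x : ℕ → R) {l : List ℕ} {N : ℕ}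
    (h : l.length ≤ N + 1) :
    ∏ i ∈ Finset.range N, x (i + 2) ^ wordOcc p (i + 2) l = patternWeight p x l := by
  have key : ∀ M, l.length ≤ M + 1 → ∏ i ∈ Finset.range (M + 1), x (i + 2) ^ wordOcc p (i + 2) l =
      ∏ i ∈ Finset.range M, x (i + 2) ^ wordOcc p (i + 2) l := by
    intro M hM
    rw [Finset.prod_range_succ, wordOcc_eq_zero (by omega), pow_zero, mul_one]
  have key' : ∀ M, l.length ≤ M → ∏ i ∈ Finset.range M, x (i + 2) ^ wordOcc p (i + 2) l =
      patternWeight p x l := by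
    intro M hM
    induction M, hM using Nat.le_induction with
    | base => rfl
    | succ M hM ih => rw [key M (by omega), ih]
  rw [← key N h, key' _ h]

theorem motzkinWeight_eq_patternWeight (x y : ℕ → R) {n : ℕ} (π : Equiv.Perm (Fin n)) :
    motzkinWeight x y π = patternWeight id x (permWord π) *
      patternWeight (Equiv.swap 0 1) y (permWord π) := by
  have h : Finset.Icc 2 n = Finset.Ico 2 (n + 1) := rfl
  rw [motzkinWeight, h, Finset.prod_Ico_eq_prod_range, Finset.prod_mul_distrib,
    ← prod_range_eq_patternWeight id x (N := n + 1 - 2) (by simp; omega),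
    ← prod_range_eq_patternWeight (Equiv.swap 0 1) y (N := n + 1 - 2) (by simp; omega)]
  congr 1 <;> refine Finset.prod_congr rfl fun i _ => ?_
  · rw [add_comm 2 i, ← numOccurrences_eq_wordOcc]
    rfl
  · rw [add_comm 2 i, ← numOccurrences_eq_wordOcc]
    rfl

theorem patternWeight_rise_skewSum {p : ℕ → ℕ} (hp : ∀ k a, a < k → p a < p k) (x : ℕ → R)
    {σ τ : List ℕ} (hτ : IsWord τ) :
    patternWeight p x (skewSum σ τ) = patternWeight p x σ * patternWeight p x τ := by
  rw [← prod_range_eq_patternWeight p x (l := σ) (N := σ.length + τ.length) (by omega),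
    ← prod_range_eq_patternWeight p x (l := τ) (N := σ.length + τ.length) (by omega),
    patternWeight, length_skewSum, ← Finset.prod_mul_distrib]
  refine Finset.prod_congr rfl fun i _ => ?_
  rw [wordOcc_skewSum (hp _) hτ, pow_add]

/-- Only the length-two pattern fails to end in its largest letter; its factor is peeled off, and
the junction descent adds one `x 2`. -/
theorem patternWeight_desc_skewSum {p : ℕ → ℕ} (hp : ∀ k a, 2 ≤ k → a < k → p a < p k)
    (h01 : p 1 < p 0) (x : ℕ → R) {σ τ : List ℕ} (hτ : IsWord τ) :
    patternWeight p x (skewSum σ τ) = patternWeight p x σ * patternWeight p x τ *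
      if σ = [] ∨ τ = [] then 1 else x 2 := by
  rw [← prod_range_eq_patternWeight p x (l := σ) (N := σ.length + τ.length + 1) (by omega),
    ← prod_range_eq_patternWeight p x (l := τ) (N := σ.length + τ.length + 1) (by omega),
    ← prod_range_eq_patternWeight p x (l := skewSum σ τ) (N := σ.length + τ.length + 1)
      (by simp; omega),
    Finset.prod_range_succ', Finset.prod_range_succ' (n := σ.length + τ.length),
    Finset.prod_range_succ' (n := σ.length + τ.length)]
  have : ∀ i, x (i + 1 + 2) ^ wordOcc p (i + 1 + 2) (skewSum σ τ) =
      x (i + 1 + 2) ^ wordOcc p (i + 1 + 2) σ * x (i + 1 + 2) ^ wordOcc p (i + 1 + 2) τ := by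
    intro i
    rw [wordOcc_skewSum (hp _ · (by omega)) hτ, pow_add]
  simp only [this, Finset.prod_mul_distrib, zero_add, wordOcc_two_desc_skewSum h01 hτ, pow_add]
  split_ifs <;> ring

/-- An occurrence of length `j` in `σ` counts once for `j` and, extended by the new letter, once for
`j + 1`. Its weight is thus `x j * x (j + 1)`, the shifted variable; `e` counts the new length-two
occurrences. -/
theorem patternWeight_addTop {p : ℕ → ℕ} (hp : ∀ k a, 2 ≤ k → a < k → p a < p k) (x : ℕ → R)
    {σ : List ℕ} (hσ : IsWord σ) {e : ℕ} (h2 : wordOcc p 2 (addTop σ) = wordOcc p 2 σ + e) :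
    patternWeight p x (addTop σ) = patternWeight p (shiftVars x) σ * x 2 ^ e := by
  have h : ∀ i, x (i + 1 + 2) ^ wordOcc p (i + 1 + 2) (addTop σ) =
      x (i + 1 + 2) ^ wordOcc p (i + 1 + 2) σ * x (i + 1 + 2) ^ wordOcc p (i + 2) σ := by
    intro i
    rw [show i + 1 + 2 = i + 2 + 1 by ring, wordOcc_addTop (by omega) (hp _ · (by omega)) hσ,
      pow_add]
  have h' := prod_range_eq_patternWeight p x (l := σ) (N := σ.length + 1) (by omega)
  rw [← prod_range_eq_patternWeight p x (l := σ) (N := σ.length) (by omega),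
    Finset.prod_range_succ'] at h'
  rw [patternWeight, length_addTop, Finset.prod_range_succ']
  simp only [h, Finset.prod_mul_distrib, patternWeight, shiftVars, mul_pow]
  rw [← h', zero_add, h2, pow_add]
  ring_nf

end Weight

/-! ### The functional equation for power series -/

section GeneratingFunction

variable {R : Type*} [CommRing R]

/-- The weight of a word. -/
noncomputable def wordWeight (x y : ℕ → R) (l : List ℕ) : R :=
  patternWeight id x l * patternWeight (Equiv.swap 0 1) y l

theorem coeff_motzkinGF (x y : ℕ → R) (n : ℕ) :
    PowerSeries.coeff n (motzkinGF x y) = ∑ l ∈ motzkinWords n, wordWeight x y l := by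
  rw [motzkinGF, PowerSeries.coeff_mk, motzkinWords,
    Finset.sum_image fun _ _ _ _ h => permWord_injective h]
  exact Finset.sum_congr rfl fun π _ => motzkinWeight_eq_patternWeight x y π

theorem swap_lt_of_lt (k a : ℕ) (hk : 2 ≤ k) (ha : a < k) :
    Equiv.swap 0 1 a < Equiv.swap 0 1 k := by
  rw [Equiv.swap_apply_of_ne_of_ne (by omega) (by omega : k ≠ 1), Equiv.swap_apply_def]
  split_ifs <;> omega

theorem wordWeight_nil (x y : ℕ → R) : wordWeight x y [] = 1 := by
  simp [wordWeight, patternWeight]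

theorem wordWeight_skewSum (x y : ℕ → R) {σ τ : List ℕ} (hτ : IsWord τ) :
    wordWeight x y (skewSum σ τ) =
      wordWeight x y σ * wordWeight x y τ * if σ = [] ∨ τ = [] then 1 else y 2 := by
  rw [wordWeight, patternWeight_rise_skewSum (p := id) (fun _ _ h => h) x hτ,
    patternWeight_desc_skewSum swap_lt_of_lt (by simp) y hτ, wordWeight, wordWeight]
  ring

theorem wordWeight_addTop (x y : ℕ → R) {σ : List ℕ} (hσ : IsWord σ) :
    wordWeight x y (addTop σ) =
      wordWeight (shiftVars x) (shiftVars y) σ * if σ = [] then 1 else x 2 := by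
  rw [wordWeight, patternWeight_addTop (p := id) (fun _ _ _ h => h) x hσ
      (wordOcc_two_rise_addTop (p := id) Nat.zero_lt_one hσ),
    patternWeight_addTop (e := 0) swap_lt_of_lt y hσ
      (wordOcc_two_desc_addTop (by simp) hσ), wordWeight]
  split_ifs <;> ring

theorem wordWeight_singleton (x y : ℕ → R) : wordWeight x y [0] = 1 := by
  have := wordWeight_addTop x y isWord_nil
  rwa [wordWeight_nil, if_pos rfl, one_mul] at this

theorem motzkinGF_coeff_zero (x y : ℕ → R) : PowerSeries.coeff 0 (motzkinGF x y) = 1 := by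
  rw [coeff_motzkinGF, motzkinWords_zero, Finset.sum_singleton, wordWeight_nil]

/-- The contribution to the generating function of the part of a Motzkin permutation up to its
largest letter. -/
noncomputable def headGF (x y : ℕ → R) : R⟦X⟧ :=
  1 + PowerSeries.X * PowerSeries.C (x 2 * (1 - y 2 * y 3)) +
    PowerSeries.X * PowerSeries.C (x 2 * y 2 * y 3) * motzkinGF (shiftVars x) (shiftVars y)

/-- A head is empty or `skewSum ρ [0]`. The latter brings t for the letter 0, x_2 for the rise to
the top and, if `ρ` is nonempty, a descent of shifted weight y_2 y_3. The sum 1 + t x_2 (1 + y_2 y_3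
(F' - 1)), with F' = F(t, X', Y'), is `headGF`. -/
theorem coeff_headGF (x y : ℕ → R) (k : ℕ) :
    PowerSeries.coeff k (headGF x y) = ∑ σ ∈ motzkinHeads k,
      wordWeight (shiftVars x) (shiftVars y) σ * if σ = [] then 1 else x 2 := by
  rcases k with _ | k
  · simp [headGF, motzkinHeads, wordWeight_nil, mul_assoc]
  · have hinj : ∀ ρ ∈ motzkinWords k, ∀ ρ' ∈ motzkinWords k,
        skewSum ρ [0] = skewSum ρ' [0] → ρ = ρ' := by
      intro ρ _ ρ' _ h
      exact List.map_injective_iff.2 (add_left_injective _) (List.append_left_injective _ h)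
    have hw : ∀ ρ ∈ motzkinWords k,
        (wordWeight (shiftVars x) (shiftVars y) (skewSum ρ [0]) *
          if skewSum ρ [0] = [] then 1 else x 2) =
        wordWeight (shiftVars x) (shiftVars y) ρ * if k = 0 then x 2 else x 2 * y 2 * y 3 := by
      intro ρ hρ
      have hk : ρ = [] ↔ k = 0 := by
        rw [← List.length_eq_zero_iff, (mem_motzkinWords.1 hρ).1]
      have h0 : skewSum ρ [0] ≠ [] := by simp [skewSum]
      rw [wordWeight_skewSum _ _ isWord_singleton, wordWeight_singleton, if_neg h0]
      simp only [hk, List.cons_ne_nil, or_false, shiftVars]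
      split_ifs <;> ring
    rw [motzkinHeads, Finset.sum_image hinj, Finset.sum_congr rfl hw, ← Finset.sum_mul,
      ← coeff_motzkinGF, headGF, mul_assoc PowerSeries.X]
    simp only [map_add, PowerSeries.coeff_succ_X_mul, PowerSeries.coeff_C_mul,
      PowerSeries.coeff_one, PowerSeries.coeff_C]
    rcases k with _ | k
    · rw [motzkinGF_coeff_zero]
      simp only [if_pos, Nat.succ_ne_zero, if_neg, not_false_eq_true]
      ring
    · simp [mul_comm]

/-- The factor y_2 records the descent from the head to a nonempty tail. -/
theorem coeff_tailGF (x y : ℕ → R) (n : ℕ) :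
    PowerSeries.coeff n (1 + PowerSeries.C (y 2) * (motzkinGF x y - 1)) =
      ∑ τ ∈ motzkinWords n, wordWeight x y τ * if τ = [] then 1 else y 2 := by
  have hw : ∀ τ ∈ motzkinWords n, (wordWeight x y τ * if τ = [] then 1 else y 2) =
      wordWeight x y τ * if n = 0 then 1 else y 2 := by
    intro τ hτ
    have hn : τ = [] ↔ n = 0 := by
      rw [← List.length_eq_zero_iff, (mem_motzkinWords.1 hτ).1]
    simp only [hn]
  rw [Finset.sum_congr rfl hw, ← Finset.sum_mul, ← coeff_motzkinGF]
  simp only [map_add, map_sub, PowerSeries.coeff_C_mul, PowerSeries.coeff_one]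
  rcases n with _ | n
  · rw [motzkinGF_coeff_zero]
    simp
  · simp [mul_comm]

theorem motzkinGF_eq (x y : ℕ → R) :
    motzkinGF x y = 1 + PowerSeries.X *
      (headGF x y * (1 + PowerSeries.C (y 2) * (motzkinGF x y - 1))) := by
  ext n
  rcases n with _ | n
  · rw [motzkinGF_coeff_zero]
    simp
  · rw [map_add, PowerSeries.coeff_succ_X_mul, PowerSeries.coeff_mul, coeff_motzkinGF,
      sum_motzkinWords_succ, PowerSeries.coeff_one, if_neg (Nat.succ_ne_zero n), zero_add]
    refine Finset.sum_congr rfl fun kl _ => ?_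
    rw [coeff_headGF, coeff_tailGF, Finset.sum_mul_sum, ← Finset.sum_product']
    refine Finset.sum_congr rfl fun στ h => ?_
    obtain ⟨h1, h2⟩ := Finset.mem_product.1 h
    rw [wordWeight_skewSum _ _ (mem_motzkinWords.1 h2).2.1,
      wordWeight_addTop _ _ (mem_motzkinHeads.1 h1).2.1]
    have : addTop στ.1 ≠ [] := by simp [addTop]
    simp only [this, false_or]
    ring

end GeneratingFunction

/-! ### Iterated shifts and the continued fraction -/

/-- Pascal's rule in the exponents. -/
theorem iterate_shiftVars {R : Type*} [CommRing R] (m : ℕ) (x : ℕ → R) (j : ℕ) :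
    (shiftVars^[m] x) j = ∏ i ∈ Finset.range (m + 1), x (i + j) ^ m.choose i := by
  induction m generalizing j with
  | zero => simp
  | succ m ih =>
    rw [Function.iterate_succ_apply', shiftVars, ih, ih,
      Finset.prod_pow_choose_succ (fun i _ => x (i + j))]
    congr 1
    refine Finset.prod_congr rfl fun i _ => ?_
    rw [add_right_comm, add_assoc]

theorem iterate_shiftVars_two {R : Type*} [CommRing R] (m : ℕ) (x : ℕ → R) :
    (shiftVars^[m] x) 2 = cfMonomial x m :=
  iterate_shiftVars m x 2

/-- The errors of the convergents of a continued fraction with tails `T n`. -/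
theorem GenContFract.error_succ {L : Type*} [Field L] {g : GenContFract L} {a b T : ℕ → L} {f : L}
    (hg : ∀ n, g.s.get? n = some ⟨a n, b n⟩) (hf : f = g.h + a 0 / T 0) (hT0 : ∀ n, T n ≠ 0)
    (hT : ∀ n, T n = b n + a (n + 1) / T (n + 1)) (n : ℕ) :
    f * g.dens (n + 1) - g.nums (n + 1) =
      -(a (n + 1) * (f * g.dens n - g.nums n) / T (n + 1)) := by
  induction n with
  | zero =>
    have h : a 0 / T 0 * T 0 = a 0 := div_mul_cancel₀ _ (hT0 0)
    rw [zero_add, first_den_eq (hg 0), first_num_eq (hg 0), zeroth_den_eq_one, zeroth_num_eq_h, hf]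
    have h' := hT 0
    rw [zero_add] at h'
    linear_combination h - a 0 / T 0 * h'
  | succ n ih =>
    -- The errors obey the three-term recurrence, so this relation gives E_{n+2} = E_{n+1}(b_{n+1} -
    -- T_{n+1}).
    have h : a (n + 1) * (f * g.dens n - g.nums n) =
        -((f * g.dens (n + 1) - g.nums (n + 1)) * T (n + 1)) := by
      rw [ih, neg_mul, neg_neg, div_mul_cancel₀ _ (hT0 _)]
    rw [dens_recurrence (hg (n + 1)) rfl rfl, nums_recurrence (hg (n + 1)) rfl rfl]
    linear_combination h - (f * g.dens (n + 1) - g.nums (n + 1)) * hT (n + 1)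

theorem GenContFract.dens_succ_succ {L : Type*} [Field L] {g : GenContFract L} {a b : ℕ → L}
    (hg : ∀ n, g.s.get? n = some ⟨a n, b n⟩) (n : ℕ) :
    g.dens (n + 2) = b (n + 1) * g.dens (n + 1) + a (n + 1) * g.dens n :=
  dens_recurrence (hg (n + 1)) rfl rfl

section ContinuedFraction

variable {K : Type*} [Field K]

open HahnSeries (ofPowerSeries)

theorem ofPowerSeries_ne_zero_of_constantCoeff {f : K⟦X⟧}
    (hf : PowerSeries.constantCoeff f ≠ 0) : ofPowerSeries ℤ K f ≠ 0 := by
  intro h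
  rw [HahnSeries.ofPowerSeries_injective (h.trans (map_zero _).symm), map_zero] at hf
  exact hf rfl

theorem ofPowerSeries_inv_of_constantCoeff {f : K⟦X⟧}
    (hf : PowerSeries.constantCoeff f ≠ 0) :
    ofPowerSeries ℤ K f⁻¹ = (ofPowerSeries ℤ K f)⁻¹ := by
  refine eq_inv_of_mul_eq_one_left ?_
  rw [← map_mul, PowerSeries.inv_mul_cancel _ hf, map_one]

theorem tVar_ne_zero : tVar K ≠ 0 := by
  intro h
  exact PowerSeries.X_ne_zero
    (HahnSeries.ofPowerSeries_injective (h.trans (map_zero (ofPowerSeries ℤ K)).symm))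

theorem constantCoeff_headGF (x y : ℕ → K) : PowerSeries.constantCoeff (headGF x y) = 1 := by
  simp [headGF]

theorem ofPowerSeries_headGF (x y : ℕ → K) :
    ofPowerSeries ℤ K (headGF x y) = 1 + tVar K * HahnSeries.C (x 2 * (1 - y 2 * y 3)) +
        tVar K * HahnSeries.C (x 2 * y 2 * y 3) *
          (motzkinGF (shiftVars x) (shiftVars y) : K⸨X⸩) := by
  rw [headGF]
  simp only [map_add (ofPowerSeries ℤ K), map_mul (ofPowerSeries ℤ K), map_one (ofPowerSeries ℤ K),
    PowerSeries.coe_C]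
  rfl

theorem ofPowerSeries_headGF_ne_zero (x y : ℕ → K) : ofPowerSeries ℤ K (headGF x y) ≠ 0 :=
  ofPowerSeries_ne_zero_of_constantCoeff (by simp [constantCoeff_headGF])

/-- The main denominator in the functional equation, as a power series. -/
noncomputable def mainDen (x y : ℕ → K) : K⟦X⟧ :=
  PowerSeries.X * PowerSeries.C (y 2) - (headGF x y)⁻¹

theorem constantCoeff_mainDen (x y : ℕ → K) : PowerSeries.constantCoeff (mainDen x y) = -1 := by
  simp [mainDen, constantCoeff_headGF]

theorem ofPowerSeries_mainDen (x y : ℕ → K) :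
    ofPowerSeries ℤ K (mainDen x y) =
      tVar K * HahnSeries.C (y 2) - 1 / ofPowerSeries ℤ K (headGF x y) := by
  rw [mainDen, map_sub, map_mul, PowerSeries.coe_C,
    ofPowerSeries_inv_of_constantCoeff (by simp [constantCoeff_headGF]), one_div]
  rfl

theorem ofPowerSeries_mainDen_ne_zero (x y : ℕ → K) : ofPowerSeries ℤ K (mainDen x y) ≠ 0 :=
  ofPowerSeries_ne_zero_of_constantCoeff (by simp [constantCoeff_mainDen])

theorem motzkinGF_eq_one_sub_div (x y : ℕ → K) :
    (motzkinGF x y : K⸨X⸩) = 1 - tVar K / ofPowerSeries ℤ K (mainDen x y) := by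
  have h := congrArg (ofPowerSeries ℤ K) (motzkinGF_eq x y)
  simp only [map_add, map_sub, map_mul, map_one, PowerSeries.coe_C] at h
  change _ = 1 + tVar K * _ at h
  have hU := ofPowerSeries_mainDen_ne_zero x y
  have hD := ofPowerSeries_headGF_ne_zero x y
  -- With U = `mainDen`, HU = t y_2 H - 1, so the functional equation reads (F - 1)HU = -tH, and H
  -- cancels.
  have hDU : ofPowerSeries ℤ K (headGF x y) * ofPowerSeries ℤ K (mainDen x y) =
      tVar K * HahnSeries.C (y 2) * ofPowerSeries ℤ K (headGF x y) - 1 := by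
    rw [ofPowerSeries_mainDen]
    field_simp
  rw [eq_sub_iff_add_eq, ← eq_sub_iff_add_eq', div_eq_iff hU]
  apply mul_left_cancel₀ hD
  linear_combination (-1) * h + ((ofPowerSeries ℤ K) (motzkinGF x y) - 1) * hDU

/-- The iterated main denominators. -/
noncomputable def iterMainDen (x y : ℕ → K) (m : ℕ) : K⟦X⟧ :=
  mainDen (shiftVars^[m] x) (shiftVars^[m] y)

/-- The iterated head series. -/
noncomputable def iterHeadGF (x y : ℕ → K) (m : ℕ) : K⟦X⟧ :=
  headGF (shiftVars^[m] x) (shiftVars^[m] y)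

theorem iterMainDen_eq (x y : ℕ → K) (m : ℕ) :
    ofPowerSeries ℤ K (iterMainDen x y m) = cfDen x y (2 * m) +
      cfNum x y (2 * m + 1) / ofPowerSeries ℤ K (iterHeadGF x y m) := by
  rw [iterMainDen, ofPowerSeries_mainDen, iterHeadGF, iterate_shiftVars_two, cfDen, cfNum,
    if_neg (by omega), if_neg (by omega), if_pos (by omega), Nat.mul_div_cancel_left _ two_pos]
  ring

/-- Substituting F' = 1 - t/U' into H, the 1 cancels the term -t x_2 y_2 y_3 and leaves 1 + t x_2 -
t² x_2 y_2 y_3 / U', in the variables shifted `m` times. -/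
theorem iterHeadGF_eq (x y : ℕ → K) (m : ℕ) :
    ofPowerSeries ℤ K (iterHeadGF x y m) = cfDen x y (2 * m + 1) +
      cfNum x y (2 * m + 2) / ofPowerSeries ℤ K (iterMainDen x y (m + 1)) := by
  have hy : (shiftVars^[m] y) 2 * (shiftVars^[m] y) 3 = cfMonomial y (m + 1) := by
    rw [← iterate_shiftVars_two, Function.iterate_succ_apply']
    rfl
  have h1 : (shiftVars^[m] x) 2 * (1 - (shiftVars^[m] y) 2 * (shiftVars^[m] y) 3) =
      cfMonomial x m - cfMonomial x m * cfMonomial y (m + 1) := by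
    rw [hy, iterate_shiftVars_two]
    ring
  have h2 : (shiftVars^[m] x) 2 * (shiftVars^[m] y) 2 * (shiftVars^[m] y) 3 =
      cfMonomial x m * cfMonomial y (m + 1) := by
    rw [mul_assoc, hy, iterate_shiftVars_two]
  rw [iterHeadGF, ofPowerSeries_headGF, h1, h2, ← Function.iterate_succ_apply' shiftVars,
    ← Function.iterate_succ_apply' shiftVars, motzkinGF_eq_one_sub_div, iterMainDen, cfDen,
    cfNum, if_pos (by omega), if_neg (by omega), if_neg (by omega),
    show (2 * m + 1) / 2 = m by omega, show (2 * m + 2) / 2 = m + 1 by omega, Nat.add_sub_cancel,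
    map_sub]
  ring

theorem motzkinCF_get? (x y : ℕ → K) (n : ℕ) :
    (motzkinCF x y).s.get? n = some ⟨cfNum x y n, cfDen x y n⟩ := rfl

theorem motzkinCF_dens_succ (x y : ℕ → K) (n : ℕ) :
    (motzkinCF x y).dens (n + 2) = cfDen x y (n + 1) * (motzkinCF x y).dens (n + 1) +
      cfNum x y (n + 1) * (motzkinCF x y).dens n :=
  GenContFract.dens_succ_succ (motzkinCF_get? x y) n

theorem cfDen_even (x y : ℕ → K) (m : ℕ) :
    cfDen x y (2 * m) = ofPowerSeries ℤ K (PowerSeries.X * PowerSeries.C (cfMonomial y m)) := by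
  rw [cfDen, if_neg (by omega), Nat.mul_div_cancel_left _ two_pos, map_mul, PowerSeries.coe_C]
  rfl

theorem cfDen_odd (x y : ℕ → K) (m : ℕ) :
    cfDen x y (2 * m + 1) =
      ofPowerSeries ℤ K (1 + PowerSeries.X * PowerSeries.C (cfMonomial x m)) := by
  rw [cfDen, if_pos (by omega), show (2 * m + 1) / 2 = m by omega, map_add, map_mul, map_one,
    PowerSeries.coe_C]
  rfl

theorem cfNum_odd (x y : ℕ → K) (m : ℕ) : cfNum x y (2 * m + 1) = -1 := by
  rw [cfNum, if_neg (by omega), if_pos (by omega)]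

theorem cfNum_even (x y : ℕ → K) (m : ℕ) :
    cfNum x y (2 * m + 2) = ofPowerSeries ℤ K
      (-(PowerSeries.X ^ 2 * PowerSeries.C (cfMonomial x m * cfMonomial y (m + 1)))) := by
  rw [cfNum, if_neg (by omega), if_neg (by omega), show (2 * m + 2) / 2 = m + 1 by omega,
    Nat.add_sub_cancel, map_neg, map_mul (ofPowerSeries ℤ K), map_pow, PowerSeries.coe_C]
  rfl

/-- Modulo higher powers of t, B_{2m+2} is -B_{2m}, and B_{2m+3} is t b_{m+1} B_{2m+2}. Nonvanishing
of the b_m keeps the odd denominators at order exactly 1. -/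
theorem exists_dens_eq (x y : ℕ → K) (hy : ∀ m, cfMonomial y m ≠ 0) (m : ℕ) :
    ∃ u w : K⟦X⟧, PowerSeries.constantCoeff u ≠ 0 ∧ PowerSeries.constantCoeff w ≠ 0 ∧
      (motzkinCF x y).dens (2 * m) = ofPowerSeries ℤ K u ∧
      (motzkinCF x y).dens (2 * m + 1) = ofPowerSeries ℤ K (PowerSeries.X * w) := by
  induction m with
  | zero =>
    refine ⟨1, PowerSeries.C (cfMonomial y 0), by simp, by simpa using hy 0, ?_, ?_⟩
    · rw [map_one]
      exact GenContFract.zeroth_den_eq_one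
    · rw [← cfDen_even x y 0]
      exact GenContFract.first_den_eq (motzkinCF_get? x y 0)
  | succ m ih =>
    obtain ⟨u, w, hu, hw, h1, h2⟩ := ih
    have h3 : (motzkinCF x y).dens (2 * m + 2) = ofPowerSeries ℤ K
        ((1 + PowerSeries.X * PowerSeries.C (cfMonomial x m)) * (PowerSeries.X * w) - u) := by
      rw [motzkinCF_dens_succ, cfNum_odd, cfDen_odd, h1, h2, map_sub, neg_one_mul, ← sub_eq_add_neg,
        ← map_mul]
    refine ⟨_, PowerSeries.C (cfMonomial y (m + 1)) *
      (((1 + PowerSeries.X * PowerSeries.C (cfMonomial x m)) * (PowerSeries.X * w) - u) -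
        PowerSeries.X ^ 2 * PowerSeries.C (cfMonomial x m) * w), ?_, ?_, h3, ?_⟩
    · simpa using hu
    · simpa using ⟨hy (m + 1), hu⟩
    · rw [show 2 * (m + 1) + 1 = 2 * m + 1 + 2 by ring, motzkinCF_dens_succ,
        show 2 * m + 1 + 1 = 2 * m + 2 by ring, h3, h2, cfNum_even,
        show 2 * m + 2 = 2 * (m + 1) by ring, cfDen_even, ← map_mul, ← map_mul, ← map_add]
      congr 1
      rw [map_mul PowerSeries.C]
      ring

/-- The error of a convergent, multiplied by its denominator. -/
noncomputable def cfError (x y : ℕ → K) (n : ℕ) : K⸨X⸩ :=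
  (motzkinGF x y : K⸨X⸩) * (motzkinCF x y).dens n - (motzkinCF x y).nums n

/-- The tails of the continued fraction. -/
noncomputable def cfTail (x y : ℕ → K) (n : ℕ) : K⟦X⟧ :=
  if n % 2 = 1 then iterHeadGF x y (n / 2) else iterMainDen x y (n / 2)

theorem cfTail_even (x y : ℕ → K) (m : ℕ) : cfTail x y (2 * m) = iterMainDen x y m := by
  rw [cfTail, if_neg (by omega), Nat.mul_div_cancel_left _ two_pos]

theorem cfTail_odd (x y : ℕ → K) (m : ℕ) : cfTail x y (2 * m + 1) = iterHeadGF x y m := by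
  rw [cfTail, if_pos (by omega), show (2 * m + 1) / 2 = m by omega]

theorem constantCoeff_cfTail_ne_zero (x y : ℕ → K) (n : ℕ) :
    PowerSeries.constantCoeff (cfTail x y n) ≠ 0 := by
  rw [cfTail]
  split_ifs
  · simp [iterHeadGF, constantCoeff_headGF]
  · simp [iterMainDen, constantCoeff_mainDen]

theorem cfTail_eq (x y : ℕ → K) (n : ℕ) :
    ofPowerSeries ℤ K (cfTail x y n) =
      cfDen x y n + cfNum x y (n + 1) / ofPowerSeries ℤ K (cfTail x y (n + 1)) := by
  rcases Nat.even_or_odd' n with ⟨m, rfl | rfl⟩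
  · rw [cfTail_even, cfTail_odd, iterMainDen_eq]
  · rw [cfTail_odd, show 2 * m + 1 + 1 = 2 * (m + 1) by ring, cfTail_even, iterHeadGF_eq]
    rfl

theorem motzkinGF_eq_add_div (x y : ℕ → K) :
    (motzkinGF x y : K⸨X⸩) =
      (motzkinCF x y).h + cfNum x y 0 / ofPowerSeries ℤ K (cfTail x y 0) := by
  rw [motzkinGF_eq_one_sub_div, cfNum, if_pos rfl, neg_div, ← sub_eq_add_neg]
  rfl

theorem cfError_succ (x y : ℕ → K) (n : ℕ) :
    cfError x y (n + 1) = -(cfNum x y (n + 1) * cfError x y n *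
      ofPowerSeries ℤ K (cfTail x y (n + 1))⁻¹) := by
  rw [ofPowerSeries_inv_of_constantCoeff (constantCoeff_cfTail_ne_zero x y _), ← div_eq_mul_inv]
  exact GenContFract.error_succ (motzkinCF_get? x y) (motzkinGF_eq_add_div x y)
    (T := fun n => ofPowerSeries ℤ K (cfTail x y n))
    (fun n => ofPowerSeries_ne_zero_of_constantCoeff (constantCoeff_cfTail_ne_zero x y n))
    (cfTail_eq x y) n

theorem cfError_zero (x y : ℕ → K) :
    cfError x y 0 = ofPowerSeries ℤ K (PowerSeries.X * -(cfTail x y 0)⁻¹) := by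
  rw [cfError, GenContFract.zeroth_den_eq_one, GenContFract.zeroth_num_eq_h, mul_one,
    motzkinGF_eq_add_div, add_sub_cancel_left, map_mul, map_neg,
    ofPowerSeries_inv_of_constantCoeff (constantCoeff_cfTail_ne_zero x y 0), cfNum, if_pos rfl,
    div_eq_mul_inv, neg_mul, mul_neg]
  rfl

/-- Dividing by a tail costs no power of t; odd-indexed numerators are -1, and even-indexed ones
after the first contribute t². -/
theorem exists_cfError_eq (x y : ℕ → K) (m : ℕ) :
    ∃ v w : K⟦X⟧, cfError x y (2 * m) = ofPowerSeries ℤ K (PowerSeries.X ^ (2 * m + 1) * v) ∧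
      cfError x y (2 * m + 1) = ofPowerSeries ℤ K (PowerSeries.X ^ (2 * m + 1) * w) := by
  have step : ∀ m v, cfError x y (2 * m) = ofPowerSeries ℤ K (PowerSeries.X ^ (2 * m + 1) * v) →
      cfError x y (2 * m + 1) = ofPowerSeries ℤ K
        (PowerSeries.X ^ (2 * m + 1) * (v * (cfTail x y (2 * m + 1))⁻¹)) := by
    intro m v h
    rw [cfError_succ, h, cfNum_odd, neg_one_mul, neg_mul, neg_neg, ← map_mul, mul_assoc]
  induction m with
  | zero =>
    have h : cfError x y (2 * 0) =
        ofPowerSeries ℤ K (PowerSeries.X ^ (2 * 0 + 1) * -(cfTail x y 0)⁻¹) := by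
      rw [mul_zero, cfError_zero, zero_add, pow_one]
    exact ⟨_, _, h, step 0 _ h⟩
  | succ m ih =>
    obtain ⟨v, w, -, h2⟩ := ih
    have h : cfError x y (2 * (m + 1)) = ofPowerSeries ℤ K (PowerSeries.X ^ (2 * (m + 1) + 1) *
        (PowerSeries.C (cfMonomial x m * cfMonomial y (m + 1)) * w *
          (cfTail x y (2 * m + 2))⁻¹)) := by
      rw [show 2 * (m + 1) = 2 * m + 1 + 1 by ring, cfError_succ, h2, cfNum_even, ← map_mul,
        ← map_mul, ← map_neg]
      congr 1
      ring
    exact ⟨_, _, h, step (m + 1) _ h⟩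

theorem coeff_X_pow_mul_eq_zero (f : K⟦X⟧) {n : ℕ} {i : ℤ} (hi : i < n) :
    (ofPowerSeries ℤ K (PowerSeries.X ^ n * f)).coeff i = 0 := by
  rw [PowerSeries.coeff_coe]
  split_ifs with h
  · rfl
  · rw [PowerSeries.coeff_X_pow_mul', if_neg (by omega)]

theorem motzkinCF_dens_ne_zero (x y : ℕ → K) (hy : ∀ m, cfMonomial y m ≠ 0) (n : ℕ) :
    (motzkinCF x y).dens n ≠ 0 := by
  obtain ⟨u, w, hu, hw, h1, h2⟩ := exists_dens_eq x y hy (n / 2)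
  rcases Nat.even_or_odd' n with ⟨m, rfl | rfl⟩
  · rw [Nat.mul_div_cancel_left _ two_pos] at h1
    rw [h1]
    exact ofPowerSeries_ne_zero_of_constantCoeff hu
  · rw [show (2 * m + 1) / 2 = m by omega] at h2
    rw [h2, map_mul]
    exact mul_ne_zero tVar_ne_zero (ofPowerSeries_ne_zero_of_constantCoeff hw)

/-- The error has order at least 2⌊n/2⌋ + 1, and dividing by the denominator loses at most one power
of t. -/
theorem exists_sub_convs_eq (x y : ℕ → K) (hy : ∀ m, cfMonomial y m ≠ 0) (n : ℕ) :
    ∃ f : K⟦X⟧, (motzkinGF x y : K⸨X⸩) - (motzkinCF x y).convs n =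
      ofPowerSeries ℤ K (PowerSeries.X ^ (2 * (n / 2)) * f) := by
  have key : (motzkinGF x y : K⸨X⸩) - (motzkinCF x y).convs n =
      cfError x y n / (motzkinCF x y).dens n := by
    have := motzkinCF_dens_ne_zero x y hy n
    rw [cfError, GenContFract.conv_eq_num_div_den]
    field_simp
  obtain ⟨u, w, hu, hw, h1, h2⟩ := exists_dens_eq x y hy (n / 2)
  obtain ⟨v, v', h3, h4⟩ := exists_cfError_eq x y (n / 2)
  rcases Nat.even_or_odd' n with ⟨m, rfl | rfl⟩
  · rw [Nat.mul_div_cancel_left _ two_pos] at h1 h3 ⊢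
    refine ⟨PowerSeries.X * v * u⁻¹, ?_⟩
    rw [key, h3, h1, div_eq_mul_inv, ← ofPowerSeries_inv_of_constantCoeff hu, ← map_mul]
    congr 1
    ring
  · rw [show (2 * m + 1) / 2 = m by omega] at h2 h4 ⊢
    refine ⟨v' * w⁻¹, ?_⟩
    have hX : ofPowerSeries ℤ K PowerSeries.X ≠ 0 := tVar_ne_zero
    rw [key, h4, h2, map_mul (ofPowerSeries ℤ K) PowerSeries.X w, pow_succ', mul_assoc,
      map_mul (ofPowerSeries ℤ K) PowerSeries.X, mul_div_mul_left _ _ hX,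
      div_eq_mul_inv, ← ofPowerSeries_inv_of_constantCoeff hw, ← map_mul, mul_assoc]

theorem hasCFValue_motzkinCF (x y : ℕ → K) (hy : ∀ m, cfMonomial y m ≠ 0) :
    HasCFValue (motzkinCF x y) (motzkinGF x y : K⸨X⸩) := by
  refine ⟨motzkinCF_dens_ne_zero x y hy, fun N => ?_⟩
  -- The bound suffices because 2⌊n/2⌋ ≥ n - 1 ≥ N.
  filter_upwards [Filter.eventually_ge_atTop (N.toNat + 1)] with n hn i hi
  obtain ⟨f, hf⟩ := exists_sub_convs_eq x y hy n
  have h := coeff_X_pow_mul_eq_zero f (n := 2 * (n / 2)) (i := i) (by omega)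
  rw [← hf, HahnSeries.coeff_sub, sub_eq_zero] at h
  exact h.symm

end ContinuedFraction

/-- For the claim about formal series take for `x j` and `y j` independent indeterminates
and for `K` the field of rational functions in them. -/
theorem mainTheorem10 {K : Type*} [Field K] (x y : ℕ → K) :
    (1 + tVar K * HahnSeries.C (x 2 * (1 - y 2 * y 3)) +
        tVar K * HahnSeries.C (x 2 * y 2 * y 3) *
          (motzkinGF (shiftVars x) (shiftVars y) : K⸨X⸩) ≠ 0 ∧
      tVar K * HahnSeries.C (y 2) -
        1 / (1 + tVar K * HahnSeries.C (x 2 * (1 - y 2 * y 3)) +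
          tVar K * HahnSeries.C (x 2 * y 2 * y 3) *
            (motzkinGF (shiftVars x) (shiftVars y) : K⸨X⸩)) ≠ 0 ∧
      (motzkinGF x y : K⸨X⸩) =
        1 - tVar K /
          (tVar K * HahnSeries.C (y 2) -
            1 / (1 + tVar K * HahnSeries.C (x 2 * (1 - y 2 * y 3)) +
              tVar K * HahnSeries.C (x 2 * y 2 * y 3) *
                (motzkinGF (shiftVars x) (shiftVars y) : K⸨X⸩)))) ∧
    ((∀ j, 2 ≤ j → y j ≠ 0) → HasCFValue (motzkinCF x y) (motzkinGF x y : K⸨X⸩)) := by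
  rw [← ofPowerSeries_headGF, ← ofPowerSeries_mainDen]
  refine ⟨⟨ofPowerSeries_headGF_ne_zero x y, ofPowerSeries_mainDen_ne_zero x y,
    motzkinGF_eq_one_sub_div x y⟩, fun hy => hasCFValue_motzkinCF x y fun m => ?_⟩
  exact Finset.prod_ne_zero_iff.2 fun i _ => pow_ne_zero _ (hy _ (by omega))
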